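/- Let $d_A,d_B$ be positive integers and let $U$ be a permutation unitary on $\mathbb C^{d_A}\otimes\mathbb C^{d_B}$, i.e. a unitary matrix in the computational product basis all of whose entries are $0$ or $1$. Suppose that $U$ has Schmidt rank three, i.e. $U=\sum_{j=1}^3 A_j\otimes B_j$ with linearly independent $d_A\times d_A$ complex matrices $A_1,A_2,A_3$ and linearly independent $d_B\times d_B$ complex matrices $B_1,B_2,B_3$. Let $$K_E(U)=\max_{|\alpha\rangle,|\beta\rangle}E\big(U(|\alpha\rangle|\beta\rangle)\big)$$ be its entangling power, where $|\alpha\rangle$ and $|\beta\rangle$ range over the pure states (unit vectors) of $AR_A$ and $BR_B$, with $A=\mathbb C^{d_A}$, $B=\mathbb C^{d_B}$ and local ancillas $R_A,R_B$ of arbitrary finite dimensions, $U$ acts on $AB$ (and as the identity on the ancillas), and $E$ is the von Neumann entropy, with logarithm to base $2$, of the reduced density matrix on $AR_A$. Then this maximum is attained, and $$\log_2 9-\tfrac{16}{9}\;\le\;K_E(U)\;\le\;\log_2 3 ,$$ where, to three decimals, $\log_2 9-\tfrac{16}{9}\approx1.392$ and $\log_2 3\approx1.585$. -/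

import Mathlib

open scoped Kronecker

namespace EntPower

/-- `U` is a permutation unitary: a unitary matrix all of whose entries are `0` or `1`. -/
def IsPermutationUnitary {n : Type*} [Fintype n] [DecidableEq n] (U : Matrix n n ℂ) : Prop :=
  U ∈ Matrix.unitaryGroup n ℂ ∧ ∀ i j, U i j = 0 ∨ U i j = 1

/-- `U`, an operator on `ℂ^a ⊗ ℂ^b`, has Schmidt rank `r`: it is a sum of `r` products `A j ⊗ B j`
with linearly independent `A j` and linearly independent `B j`. -/
def HasSchmidtRank {a b : Type*} (U : Matrix (a × b) (a × b) ℂ) (r : ℕ) : Prop :=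
  ∃ (A : Fin r → Matrix a a ℂ) (B : Fin r → Matrix b b ℂ),
    LinearIndependent ℂ A ∧ LinearIndependent ℂ B ∧ U = ∑ j, A j ⊗ₖ B j

/-- The product vector `|α⟩ ⊗ |β⟩`. -/
def productVec {x y : Type*} (α : EuclideanSpace ℂ x) (β : EuclideanSpace ℂ y) : x × y → ℂ :=
  fun p => α p.1 * β p.2

/-- The action of `U` on the systems `A`, `B` (indices `a`, `b`) of a vector of the four systems
`(A R_A)(B R_B)`, with the identity acting on the ancillas `R_A`, `R_B` (indices `r`, `s`). -/
def applyWithAncillas {a b r s : Type*} [Fintype a] [Fintype b]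
    (U : Matrix (a × b) (a × b) ℂ) (φ : (a × r) × (b × s) → ℂ) : (a × r) × (b × s) → ℂ :=
  fun p => ∑ k : a, ∑ l : b, U (p.1.1, p.2.1) (k, l) * φ ((k, p.1.2), (l, p.2.2))

/-- The operator `|ψ⟩⟨ψ|`. -/
def pureDensity {x : Type*} (ψ : x → ℂ) : Matrix x x ℂ :=
  Matrix.vecMulVec ψ (star ψ)

/-- Partial trace over the second tensor factor. -/
def partialTraceRight {x y : Type*} [Fintype y] (ρ : Matrix (x × y) (x × y) ℂ) : Matrix x x ℂ :=
  Matrix.of fun i j => ∑ k : y, ρ (i, k) (j, k)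

theorem isHermitian_partialTraceRight_pureDensity {x y : Type*} [Fintype y] (ψ : x × y → ℂ) :
    (partialTraceRight (pureDensity ψ)).IsHermitian := by
  ext i j
  simp [partialTraceRight, pureDensity, Matrix.vecMulVec_apply, mul_comm]

/-- The von Neumann entropy `-Tr (ρ log₂ ρ) = -∑ λ log₂ λ` in bits, the sum being over the
eigenvalues of `ρ` with multiplicity (`0 log 0 = 0`). -/
noncomputable def vonNeumannEntropy {x : Type*} [Fintype x] [DecidableEq x] {ρ : Matrix x x ℂ}
    (h : ρ.IsHermitian) : ℝ :=
  -∑ i, h.eigenvalues i * Real.logb 2 (h.eigenvalues i)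

/-- The entanglement (in ebits) of a bipartite pure state: the von Neumann entropy of the reduced
density matrix of the first system. -/
noncomputable def entanglement {x y : Type*} [Fintype x] [DecidableEq x] [Fintype y]
    (ψ : x × y → ℂ) : ℝ :=
  vonNeumannEntropy (isHermitian_partialTraceRight_pureDensity ψ)

/-- The values `E (U (|α⟩|β⟩))`, where `|α⟩` and `|β⟩` range over the pure states of `A R_A` and
`B R_B`, for ancillas `R_A`, `R_B` of arbitrary finite dimensions. -/
def outputEntanglements {a b : Type*} [Fintype a] [DecidableEq a] [Fintype b]
    (U : Matrix (a × b) (a × b) ℂ) : Set ℝ :=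
  {e | ∃ (r s : ℕ) (α : EuclideanSpace ℂ (a × Fin r)) (β : EuclideanSpace ℂ (b × Fin s)),
    ‖α‖ = 1 ∧ ‖β‖ = 1 ∧ e = entanglement (applyWithAncillas U (productVec α β))}

/-- The entangling power `K_E(U)`: the maximal output entanglement over all product inputs. -/
noncomputable def entanglingPower {a b : Type*} [Fintype a] [DecidableEq a] [Fintype b]
    (U : Matrix (a × b) (a × b) ℂ) : ℝ :=
  sSup (outputEntanglements U)

end EntPower

/-! The reduced state has the nonzero spectrum of a small Gram matrix: if the output is `∑ a t ⊗ b
t` with orthonormal `b t`, this is the Gram matrix of the `a t`. Entropy is therefore treated as a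
function of the characteristic polynomial, and each lower bound comes from one explicit input with
an explicit Gram matrix.

Upper bound: Schmidt rank three makes every output a sum of three product vectors, so its reduced
state has rank at most three and entropy at most log₂ 3. Attainment: the output entropy depends on
each input only through its reduced state, so ancillas of the dimensions of A and B suffice. The
inputs then form a compact set, on which the entropy is continuous.

Lower bound: let `π` be the underlying permutation of pairs. If each output coordinate depends on
the opposite input, two-term inputs with weights 2/3, 1/3 and labelled ancillas suffice
(`exists_le_outputEntanglements_of_ne`). Otherwise, up to exchanging the systems, U is a controlled
permutation `(k, l) ↦ (Q l k, w l)`, and Schmidt rank three forces three distinct `Q l`. Take β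
uniform over three such l. The Gram matrix consists of the overlaps of the images of α, and the
choice of α depends on where the three permutations agree
(`exists_le_outputEntanglements_of_controlled`). The spectrum (4/9, 4/9, 1/9), of entropy exactly
log₂ 9 − 16/9, is the worst one that occurs. -/

namespace EntPower

open Matrix Polynomial
open scoped ComplexOrder

/-! ### Entropy through characteristic polynomials -/

/-- The entropy (in bits) of the multiset of roots of a polynomial. -/
noncomputable def rootEntropy (p : ℂ[X]) : ℝ :=
  (p.roots.map fun z => -(z.re * Real.logb 2 z.re)).sum

theorem vonNeumannEntropy_eq_rootEntropy {x : Type*} [Fintype x] [DecidableEq x]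
    {ρ : Matrix x x ℂ} (h : ρ.IsHermitian) : vonNeumannEntropy h = rootEntropy ρ.charpoly := by
  simp [vonNeumannEntropy, rootEntropy, h.roots_charpoly_eq_eigenvalues]

theorem rootEntropy_X_pow_mul (m : ℕ) {p : ℂ[X]} (hp : p ≠ 0) :
    rootEntropy (X ^ m * p) = rootEntropy p := by
  rw [rootEntropy, roots_mul (mul_ne_zero (pow_ne_zero _ X_ne_zero) hp)]
  simp [rootEntropy, Multiset.map_nsmul, Multiset.sum_nsmul]

theorem rootEntropy_prod {ι : Type*} [Fintype ι] (c : ι → ℝ) :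
    rootEntropy (∏ i, (X - C (c i : ℂ))) = ∑ i, -(c i * Real.logb 2 (c i)) := by
  rw [rootEntropy, roots_prod _ _ (Finset.prod_ne_zero_iff.2 fun i _ => X_sub_C_ne_zero _)]
  simp [Multiset.bind_singleton]

/-- The characteristic polynomials of AB and BA differ by a power of X, and zero roots contribute no
entropy. -/
theorem rootEntropy_charpoly_mul_comm {m n : Type*} [Fintype m] [DecidableEq m] [Fintype n]
    [DecidableEq n] (A : Matrix m n ℂ) (B : Matrix n m ℂ) :
    rootEntropy (A * B).charpoly = rootEntropy (B * A).charpoly := by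
  rw [← rootEntropy_X_pow_mul (Fintype.card n) (charpoly_monic (A * B)).ne_zero,
    charpoly_mul_comm', rootEntropy_X_pow_mul _ (charpoly_monic _).ne_zero]

/-- The coefficient matrix of a bipartite vector. -/
def coeffMatrix {x y : Type*} (ψ : x × y → ℂ) : Matrix x y ℂ :=
  Matrix.of fun i j => ψ (i, j)


theorem partialTraceRight_pureDensity {x y : Type*} [Fintype y] (ψ : x × y → ℂ) :
    partialTraceRight (pureDensity ψ) = coeffMatrix ψ * (coeffMatrix ψ)ᴴ := by
  ext i j
  simp [partialTraceRight, pureDensity, coeffMatrix, Matrix.mul_apply, vecMulVec_apply]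

theorem entanglement_eq_rootEntropy {x y : Type*} [Fintype x] [DecidableEq x] [Fintype y]
    (ψ : x × y → ℂ) :
    entanglement ψ = rootEntropy (coeffMatrix ψ * (coeffMatrix ψ)ᴴ).charpoly := by
  rw [entanglement, vonNeumannEntropy_eq_rootEntropy, partialTraceRight_pureDensity]

theorem entanglement_swap {x y : Type*} [Fintype x] [DecidableEq x] [Fintype y] [DecidableEq y]
    (ψ : x × y → ℂ) : entanglement (fun p => ψ p.swap) = entanglement ψ := by
  have h : coeffMatrix (fun p => ψ p.swap) = (coeffMatrix ψ)ᵀ := rfl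
  rw [entanglement_eq_rootEntropy, entanglement_eq_rootEntropy, h,
    rootEntropy_charpoly_mul_comm (coeffMatrix ψ), ← charpoly_transpose,
    transpose_mul, transpose_transpose]
  rfl

/-- The entanglement of `∑ t, a t ⊗ b t` with orthonormal `b t` is the entropy of the spectrum of
the Gram matrix of the `a t`. -/
theorem entanglement_sum_eq {x y ι : Type*} [Fintype x] [DecidableEq x] [Fintype y]
    [Fintype ι] [DecidableEq ι] (a : ι → x → ℂ) (b : ι → y → ℂ) (N : Matrix ι ι ℂ) (c : ι → ℝ)
    (hb : ∀ s t, ∑ j, b s j * star (b t j) = if s = t then 1 else 0)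
    (hN : ∀ s t, ∑ i, star (a s i) * a t i = N s t)
    (hc : N.charpoly = ∏ t, (X - C (c t : ℂ))) :
    entanglement (fun p : x × y => ∑ t, a t p.1 * b t p.2) =
      ∑ t, -(c t * Real.logb 2 (c t)) := by
  set V : Matrix x ι ℂ := Matrix.of fun i t => a t i
  set W : Matrix ι y ℂ := Matrix.of fun t j => b t j
  have hM : coeffMatrix (fun p : x × y => ∑ t, a t p.1 * b t p.2) = V * W := by
    ext i j
    simp [coeffMatrix, V, W, Matrix.mul_apply]
  have hW : W * Wᴴ = 1 := by
    ext s t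
    simpa [W, Matrix.mul_apply, Matrix.one_apply] using hb s t
  have hV : Vᴴ * V = N := by
    ext s t
    simpa [V, Matrix.mul_apply] using hN s t
  rw [entanglement_eq_rootEntropy, hM, conjTranspose_mul, Matrix.mul_assoc V, ← Matrix.mul_assoc W,
    hW, Matrix.one_mul, rootEntropy_charpoly_mul_comm, hV, hc, rootEntropy_prod]

/-! ### Spectrum of the reduced state, the rank bound and continuity -/

theorem eigenvalues_nonneg {x y : Type*} [Fintype x] [DecidableEq x] [Fintype y]
    (ψ : x × y → ℂ) (i : x) :
    0 ≤ (isHermitian_partialTraceRight_pureDensity ψ).eigenvalues i := by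
  have : (partialTraceRight (pureDensity ψ)).PosSemidef := by
    rw [partialTraceRight_pureDensity]
    exact posSemidef_self_mul_conjTranspose _
  exact this.eigenvalues_nonneg i

theorem sum_eigenvalues_eq {x y : Type*} [Fintype x] [DecidableEq x] [Fintype y]
    (ψ : x × y → ℂ) :
    ∑ i, (isHermitian_partialTraceRight_pureDensity ψ).eigenvalues i = ∑ p, ‖ψ p‖ ^ 2 := by
  have h := (isHermitian_partialTraceRight_pureDensity ψ).trace_eq_sum_eigenvalues
  have h2 : (partialTraceRight (pureDensity ψ)).trace = ((∑ p, ‖ψ p‖ ^ 2 : ℝ) : ℂ) := by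
    simp [Matrix.trace, partialTraceRight, pureDensity, vecMulVec_apply, Fintype.sum_prod_type,
      Complex.mul_conj']
  rw [h2] at h
  rw [← Complex.ofReal_inj, h]
  simp

/-- This is log t ≤ t − 1 at t = 1/(r x). Summed over at most r nonzero eigenvalues of total 1, the
correction terms add up to something nonpositive, which gives the bound log₂ r. -/
theorem neg_mul_logb_le {r x : ℝ} (hr : 0 < r) (hx : 0 ≤ x) :
    -(x * Real.logb 2 x) ≤ x * Real.logb 2 r + (r⁻¹ - x) / Real.log 2 := by
  have h2 : 0 < Real.log 2 := Real.log_pos one_lt_two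
  rcases hx.eq_or_lt with rfl | hx
  · simp; positivity
  have h := Real.log_le_sub_one_of_pos (x := r⁻¹ * x⁻¹) (by positivity)
  rw [Real.log_mul (by positivity) (by positivity), Real.log_inv, Real.log_inv] at h
  have h3 : x * (-Real.log r + -Real.log x) ≤ x * (r⁻¹ * x⁻¹ - 1) := by gcongr
  have h4 : x * (r⁻¹ * x⁻¹ - 1) = r⁻¹ - x := by field_simp
  rw [Real.logb, Real.logb, ← mul_div_assoc, ← mul_div_assoc, ← neg_div, ← add_div]
  gcongr
  linarith

/-- A unit vector that is a sum of `r` product vectors has entanglement at most `log₂ r`. -/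
theorem entanglement_sum_le {x y : Type*} [Fintype x] [DecidableEq x] [Fintype y] {r : ℕ}
    (hr : 0 < r) (a : Fin r → x → ℂ) (b : Fin r → y → ℂ) (ψ : x × y → ℂ)
    (hψ : ∀ p, ψ p = ∑ t, a t p.1 * b t p.2) (h1 : ∑ p, ‖ψ p‖ ^ 2 = 1) :
    entanglement ψ ≤ Real.logb 2 r := by
  classical
  have hM : coeffMatrix ψ =
      (Matrix.of fun i t => a t i : Matrix x (Fin r) ℂ) * (Matrix.of fun t j => b t j) := by
    ext i j
    simp [coeffMatrix, Matrix.mul_apply, hψ]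
  set h := isHermitian_partialTraceRight_pureDensity ψ with hh
  have hcard : Fintype.card {i // h.eigenvalues i ≠ 0} ≤ r := by
    rw [← h.rank_eq_card_non_zero_eigs, partialTraceRight_pureDensity]
    refine (rank_mul_le_left _ _).trans ?_
    rw [hM]
    exact (rank_mul_le_left _ _).trans ((rank_le_card_width _).trans (by simp))
  rw [Fintype.card_subtype] at hcard
  have hs : ∑ i with h.eigenvalues i ≠ 0, h.eigenvalues i = 1 := by
    rw [Finset.sum_filter_ne_zero, sum_eigenvalues_eq, h1]
  have hr' : (0 : ℝ) < r := by exact_mod_cast hr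
  have h2 : 0 < Real.log 2 := Real.log_pos one_lt_two
  have hcard' : ((Finset.univ.filter fun i => h.eigenvalues i ≠ 0).card : ℝ) * (r : ℝ)⁻¹ ≤ 1 := by
    rw [← div_eq_mul_inv, div_le_one hr']
    exact_mod_cast hcard
  calc entanglement ψ
      = ∑ i with h.eigenvalues i ≠ 0, -(h.eigenvalues i * Real.logb 2 (h.eigenvalues i)) := by
        rw [entanglement, vonNeumannEntropy, ← Finset.sum_neg_distrib, Finset.sum_filter]
        refine Finset.sum_congr rfl fun i _ => ?_
        split_ifs with h0
        · rfl
        · rw [not_not.1 h0]; simp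
    _ ≤ ∑ i with h.eigenvalues i ≠ 0, (h.eigenvalues i * Real.logb 2 r +
          ((r : ℝ)⁻¹ - h.eigenvalues i) / Real.log 2) :=
        Finset.sum_le_sum fun i _ => neg_mul_logb_le hr' (eigenvalues_nonneg ψ i)
    _ ≤ Real.logb 2 r := by
        rw [Finset.sum_add_distrib, ← Finset.sum_mul, ← Finset.sum_div, Finset.sum_sub_distrib, hs,
          one_mul, Finset.sum_const, nsmul_eq_mul]
        have : ((Finset.univ.filter fun i => h.eigenvalues i ≠ 0).card * (r : ℝ)⁻¹ - 1) /
            Real.log 2 ≤ 0 := div_nonpos_of_nonpos_of_nonneg (by linarith) h2.le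
        linarith

-- The entropy is the trace of `f(ρ)` in the continuous functional calculus. On unit vectors all
-- spectra lie in the compact interval [0, 1], where the calculus is continuous in ρ.
open scoped Matrix.Norms.L2Operator in
theorem continuousOn_entanglement {x y : Type*} [Fintype x] [DecidableEq x] [Fintype y] :
    ContinuousOn (entanglement : (x × y → ℂ) → ℝ) {ψ | ∑ p, ‖ψ p‖ ^ 2 = 1} := by
  set f : ℝ → ℝ := fun t => -(t * Real.logb 2 t) with hf
  have hfc : Continuous f := by
    have : f = fun t => Real.negMulLog t / Real.log 2 := by
      ext t
      simp only [hf, Real.negMulLog, Real.logb]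
      ring
    rw [this]
    exact Real.continuous_negMulLog.div_const _
  have key : ∀ ψ : x × y → ℂ,
      entanglement ψ = (cfc f (partialTraceRight (pureDensity ψ))).trace.re := by
    intro ψ
    have h := isHermitian_partialTraceRight_pureDensity ψ
    rw [h.cfc_eq, IsHermitian.cfc, Unitary.conjStarAlgAut_apply, Matrix.trace_mul_comm,
      ← Matrix.mul_assoc]
    simp [entanglement, vonNeumannEntropy, hf, Matrix.trace_diagonal]
  have hcont : Continuous fun ψ : x × y → ℂ => partialTraceRight (pureDensity ψ) := by
    unfold partialTraceRight pureDensity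
    simp only [vecMulVec_apply]
    refine continuous_matrix fun i j => ?_
    simp only [Matrix.of_apply, Pi.star_apply]
    fun_prop
  have hcfc : ContinuousOn (fun ψ : x × y → ℂ => cfc f (partialTraceRight (pureDensity ψ)))
      {ψ | ∑ p, ‖ψ p‖ ^ 2 = 1} := by
    refine ContinuousOn.cfc' (s := Set.Icc (0 : ℝ) 1) isCompact_Icc f hcont.continuousOn ?_ ?_
      hfc.continuousOn
    · intro ψ hψ
      have h := isHermitian_partialTraceRight_pureDensity ψ
      rw [h.spectrum_real_eq_range_eigenvalues]
      rintro _ ⟨i, rfl⟩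
      refine ⟨eigenvalues_nonneg ψ i, ?_⟩
      have h1 : ∑ p, ‖ψ p‖ ^ 2 = 1 := hψ
      rw [← h1, ← sum_eigenvalues_eq]
      exact Finset.single_le_sum (fun j _ => eigenvalues_nonneg ψ j) (Finset.mem_univ i)
    · intro ψ _
      exact isHermitian_partialTraceRight_pureDensity ψ
  have htr : Continuous fun A : Matrix x x ℂ => A.trace.re :=
    Complex.continuous_re.comp (Continuous.matrix_trace continuous_id)
  exact (htr.comp_continuousOn hcfc).congr fun ψ _ => key ψ

/-! ### Permutation unitaries -/

/-- With entries in ℕ, a vanishing inner product has all its terms zero. Each column has norm one,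
hence contains a 1; column orthogonality makes the positions distinct, and row orthogonality
excludes any further 1. -/
theorem IsPermutationUnitary.exists_perm {n : Type*} [Fintype n] [DecidableEq n]
    {U : Matrix n n ℂ} (h : IsPermutationUnitary U) :
    ∃ π : Equiv.Perm n, ∀ i j, U i j = if π j = i then 1 else 0 := by
  obtain ⟨hU, h01⟩ := h
  have h01' : ∀ i j, ∃ m : ℕ, U i j = m ∧ (m = 0 ∨ m = 1) := fun i j => by
    rcases h01 i j with h | h
    · exact ⟨0, by simp [h], Or.inl rfl⟩
    · exact ⟨1, by simp [h], Or.inr rfl⟩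
  choose u hu hu01 using h01'
  have hcol : ∀ j j', ∑ i, u i j * u i j' = if j = j' then 1 else 0 := fun j j' => by
    have := congrFun (congrFun (mem_unitaryGroup_iff'.1 hU) j) j'
    simp only [star_eq_conjTranspose, Matrix.mul_apply, conjTranspose_apply, hu, star_natCast,
      Matrix.one_apply] at this
    exact_mod_cast this
  have hrow : ∀ i i', ∑ j, u i j * u i' j = if i = i' then 1 else 0 := fun i i' => by
    have := congrFun (congrFun (mem_unitaryGroup_iff.1 hU) i) i'
    simp only [star_eq_conjTranspose, Matrix.mul_apply, conjTranspose_apply, hu, star_natCast,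
      Matrix.one_apply] at this
    exact_mod_cast this
  have hex : ∀ j, ∃ i, u i j = 1 := fun j => by
    by_contra! hne
    have := hcol j j
    simp [fun i => (hu01 i j).resolve_right (hne i)] at this
  choose g hg using hex
  have hinj : Function.Injective g := fun j j' hjj => by
    by_contra hne
    have h0 := hcol j j'
    rw [if_neg hne, Finset.sum_eq_zero_iff] at h0
    have := h0 (g j) (Finset.mem_univ _)
    rw [hg j, hjj, hg j'] at this
    exact one_ne_zero this
  refine ⟨Equiv.ofBijective g (Finite.injective_iff_bijective.1 hinj), fun i j => ?_⟩
  rw [Equiv.ofBijective_apply, hu]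
  split_ifs with hij
  · rw [← hij, hg]; simp
  · have h0 := hrow (g j) i
    rw [if_neg hij, Finset.sum_eq_zero_iff] at h0
    have := h0 j (Finset.mem_univ _)
    rw [hg j, one_mul] at this
    simp [this]

/-! ### Exchange of the two systems -/

section Swap

variable {a b r s : Type*} [Fintype a] [Fintype b]

/-- The operator `U` with the two systems exchanged. -/
def swapSystems (U : Matrix (a × b) (a × b) ℂ) : Matrix (b × a) (b × a) ℂ :=
  U.submatrix Prod.swap Prod.swap

theorem applyWithAncillas_swapSystems (U : Matrix (a × b) (a × b) ℂ)
    (α : EuclideanSpace ℂ (a × r)) (β : EuclideanSpace ℂ (b × s)) :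
    applyWithAncillas (swapSystems U) (productVec β α) =
      fun p => applyWithAncillas U (productVec α β) p.swap := by
  ext p
  simp only [applyWithAncillas, productVec, swapSystems, submatrix_apply, Prod.swap]
  rw [Finset.sum_comm]
  simp only [mul_comm (α _)]

theorem entanglement_swapSystems [DecidableEq a] [DecidableEq b] [Fintype r] [DecidableEq r]
    [Fintype s] [DecidableEq s] (U : Matrix (a × b) (a × b) ℂ)
    (α : EuclideanSpace ℂ (a × r)) (β : EuclideanSpace ℂ (b × s)) :
    entanglement (applyWithAncillas (swapSystems U) (productVec β α)) =
      entanglement (applyWithAncillas U (productVec α β)) := by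
  rw [applyWithAncillas_swapSystems, entanglement_swap]

theorem outputEntanglements_swapSystems [DecidableEq a] [DecidableEq b]
    (U : Matrix (a × b) (a × b) ℂ) :
    outputEntanglements (swapSystems U) = outputEntanglements U := by
  ext e
  constructor
  · rintro ⟨s, r, β, α, hβ, hα, rfl⟩
    exact ⟨r, s, α, β, hα, hβ, entanglement_swapSystems U α β⟩
  · rintro ⟨r, s, α, β, hα, hβ, rfl⟩
    exact ⟨s, r, β, α, hβ, hα, (entanglement_swapSystems U α β).symm⟩

omit [Fintype a] [Fintype b] in
theorem HasSchmidtRank.swapSystems {U : Matrix (a × b) (a × b) ℂ} {n : ℕ}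
    (h : HasSchmidtRank U n) : HasSchmidtRank (swapSystems U) n := by
  obtain ⟨A, B, hA, hB, rfl⟩ := h
  refine ⟨B, A, hB, hA, ?_⟩
  ext p q
  simp [EntPower.swapSystems, Matrix.sum_apply, mul_comm]

end Swap

/-! ### Outputs of a permutation unitary and the upper bound -/

section Permutation

variable {a b : Type*} [Fintype a] [DecidableEq a] [Fintype b] [DecidableEq b]
  {U : Matrix (a × b) (a × b) ℂ} {π : Equiv.Perm (a × b)}

theorem applyWithAncillas_perm {r s : Type*} (hU : ∀ i j, U i j = if π j = i then 1 else 0)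
    (φ : (a × r) × (b × s) → ℂ) (p : (a × r) × (b × s)) :
    applyWithAncillas U φ p =
      φ (((π.symm (p.1.1, p.2.1)).1, p.1.2), ((π.symm (p.1.1, p.2.1)).2, p.2.2)) := by
  simp only [applyWithAncillas, hU]
  rw [← Fintype.sum_prod_type' (f := fun k l =>
    (if π (k, l) = (p.1.1, p.2.1) then (1 : ℂ) else 0) * φ ((k, p.1.2), (l, p.2.2)))]
  rw [Finset.sum_eq_single (π.symm (p.1.1, p.2.1))]
  · simp
  · intro q _ hq
    rw [if_neg, zero_mul]
    rintro h
    exact hq (by rw [← h]; simp)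
  · simp

theorem sum_norm_sq_applyWithAncillas {r s : Type*} [Fintype r] [Fintype s]
    (hU : ∀ i j, U i j = if π j = i then 1 else 0)
    (α : EuclideanSpace ℂ (a × r)) (β : EuclideanSpace ℂ (b × s)) (hα : ‖α‖ = 1) (hβ : ‖β‖ = 1) :
    ∑ p, ‖applyWithAncillas U (productVec α β) p‖ ^ 2 = 1 := by
  set e : (a × r) × (b × s) ≃ (a × r) × (b × s) :=
    ((Equiv.prodProdProdComm a r b s).trans (π.symm.prodCongr (Equiv.refl _))).trans
      (Equiv.prodProdProdComm a b r s)
  have h1 : ∀ p, applyWithAncillas U (productVec α β) p = productVec α β (e p) := fun p =>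
    applyWithAncillas_perm hU _ p
  have hα' : ∑ i, ‖α i‖ ^ 2 = 1 := by rw [← EuclideanSpace.norm_sq_eq, hα, one_pow]
  have hβ' : ∑ i, ‖β i‖ ^ 2 = 1 := by rw [← EuclideanSpace.norm_sq_eq, hβ, one_pow]
  simp_rw [h1]
  rw [e.sum_comp (fun p => ‖productVec α β p‖ ^ 2)]
  simp only [productVec, norm_mul, mul_pow, Fintype.sum_prod_type (α₁ := a × r), ← Finset.mul_sum,
    hβ', mul_one, hα']

theorem le_logb_of_mem_outputEntanglements {n : ℕ} (hn : 0 < n)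
    (hU : ∀ i j, U i j = if π j = i then 1 else 0) (hr : HasSchmidtRank U n) {e : ℝ}
    (he : e ∈ outputEntanglements U) : e ≤ Real.logb 2 n := by
  obtain ⟨A, B, -, -, hAB⟩ := hr
  obtain ⟨r, s, α, β, hα, hβ, rfl⟩ := he
  refine entanglement_sum_le hn (fun t z => ∑ k, A t z.1 k * α (k, z.2))
    (fun t z => ∑ l, B t z.1 l * β (l, z.2)) _ (fun p => ?_)
    (sum_norm_sq_applyWithAncillas hU α β hα hβ)
  simp only [applyWithAncillas, productVec, hAB, Matrix.sum_apply, kroneckerMap_apply,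
    Finset.sum_mul, Finset.mul_sum]
  rw [Finset.sum_comm, Finset.sum_comm_cycle]
  exact Finset.sum_congr rfl fun t _ => Finset.sum_congr rfl fun l _ =>
    Finset.sum_congr rfl fun k _ => by ring

end Permutation

/-! ### Reduction of the ancilla dimensions -/

section Ancilla

variable {a b r s s' : Type*} [Fintype a] [DecidableEq a] [Fintype b] [DecidableEq b]
  [Fintype r] [DecidableEq r] [Fintype s] [Fintype s']

-- This factorization isolates β: in C Cᴴ it occurs only through its reduced density matrix.
omit [DecidableEq a] [Fintype r] [DecidableEq r] [Fintype s] in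
theorem coeffMatrix_applyWithAncillas (U : Matrix (a × b) (a × b) ℂ)
    (α : EuclideanSpace ℂ (a × r)) (β : EuclideanSpace ℂ (b × s)) :
    coeffMatrix (applyWithAncillas U (productVec α β)) =
      (Matrix.of fun p q => ∑ k, U (p.1, q.1) (k, q.2) * α (k, p.2) : Matrix (a × r) (b × b) ℂ) *
        ((1 : Matrix b b ℂ) ⊗ₖ coeffMatrix β) := by
  ext p q
  simp only [coeffMatrix, applyWithAncillas, productVec, Matrix.mul_apply, of_apply,
    kroneckerMap_apply, Fintype.sum_prod_type, Matrix.one_apply, ite_mul, one_mul, zero_mul,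
    mul_ite, mul_zero]
  simp only [Finset.sum_mul, mul_assoc, Finset.sum_ite_irrel, Finset.sum_const_zero,
    Finset.sum_ite_eq', Finset.mem_univ, if_true]
  rw [Finset.sum_comm]

/-- The entanglement of the output depends on `β` only through its reduced density matrix. -/
theorem entanglement_congr_right (U : Matrix (a × b) (a × b) ℂ) (α : EuclideanSpace ℂ (a × r))
    (β : EuclideanSpace ℂ (b × s)) (β' : EuclideanSpace ℂ (b × s'))
    (h : coeffMatrix β * (coeffMatrix β)ᴴ = coeffMatrix β' * (coeffMatrix β')ᴴ) :
    entanglement (applyWithAncillas U (productVec α β)) =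
      entanglement (applyWithAncillas U (productVec α β')) := by
  have h1 : ((1 : Matrix b b ℂ) ⊗ₖ coeffMatrix β) * ((1 : Matrix b b ℂ) ⊗ₖ coeffMatrix β)ᴴ =
      ((1 : Matrix b b ℂ) ⊗ₖ coeffMatrix β') * ((1 : Matrix b b ℂ) ⊗ₖ coeffMatrix β')ᴴ := by
    rw [conjTranspose_kronecker, conjTranspose_kronecker, ← mul_kronecker_mul,
      ← mul_kronecker_mul, h]
  rw [entanglement_eq_rootEntropy, entanglement_eq_rootEntropy, coeffMatrix_applyWithAncillas,
    coeffMatrix_applyWithAncillas, conjTranspose_mul, conjTranspose_mul, Matrix.mul_assoc,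
    Matrix.mul_assoc, ← Matrix.mul_assoc (_ ⊗ₖ _), ← Matrix.mul_assoc (_ ⊗ₖ _), h1]

omit [DecidableEq b] in
theorem norm_sq_eq_trace (β : EuclideanSpace ℂ (b × s)) :
    ((‖β‖ ^ 2 : ℝ) : ℂ) = (coeffMatrix β * (coeffMatrix β)ᴴ).trace := by
  rw [EuclideanSpace.norm_sq_eq]
  simp [Matrix.trace, coeffMatrix, Matrix.mul_apply, Fintype.sum_prod_type, Complex.mul_conj']

-- The reduced density matrix is positive semidefinite, so it equals Dᴴ D with D square; Dᴴ serves
-- as the coefficient matrix of β'.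
open scoped MatrixOrder Matrix.Norms.L2Operator in
theorem exists_square_coeffMatrix (β : EuclideanSpace ℂ (b × s)) :
    ∃ β' : EuclideanSpace ℂ (b × b), ‖β'‖ = ‖β‖ ∧
      coeffMatrix β * (coeffMatrix β)ᴴ = coeffMatrix β' * (coeffMatrix β')ᴴ := by
  obtain ⟨D, hD⟩ := CStarAlgebra.nonneg_iff_eq_star_mul_self.mp
    (posSemidef_self_mul_conjTranspose (coeffMatrix β)).nonneg
  set β' : EuclideanSpace ℂ (b × b) := WithLp.toLp 2 fun p => star (D p.2 p.1)
  have h : coeffMatrix β' = Dᴴ := rfl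
  have h' : coeffMatrix β * (coeffMatrix β)ᴴ = coeffMatrix β' * (coeffMatrix β')ᴴ := by
    rw [hD, h, conjTranspose_conjTranspose]
    rfl
  refine ⟨β', ?_, h'⟩
  have h2 : ‖β'‖ ^ 2 = ‖β‖ ^ 2 := by
    rw [← Complex.ofReal_inj, norm_sq_eq_trace, norm_sq_eq_trace, h']
  exact (sq_eq_sq₀ (norm_nonneg _) (norm_nonneg _)).1 h2

end Ancilla

/-! ### Attainment of the maximum -/

theorem exists_isGreatest_outputEntanglements {m n : ℕ}
    {U : Matrix (Fin m × Fin n) (Fin m × Fin n) ℂ} {π : Equiv.Perm (Fin m × Fin n)}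
    (hU : ∀ i j, U i j = if π j = i then 1 else 0) (hne : (outputEntanglements U).Nonempty) :
    ∃ e, IsGreatest (outputEntanglements U) e := by
  set K : Set (EuclideanSpace ℂ (Fin m × Fin m) × EuclideanSpace ℂ (Fin n × Fin n)) :=
    Metric.sphere 0 1 ×ˢ Metric.sphere 0 1 with hK
  have hKc : IsCompact K := (isCompact_sphere _ _).prod (isCompact_sphere _ _)
  have hmem : ∀ {γ}, γ ∈ K ↔ ‖γ.1‖ = 1 ∧ ‖γ.2‖ = 1 := by simp [hK]
  have himage : outputEntanglements U =
      (fun γ : EuclideanSpace ℂ (Fin m × Fin m) × EuclideanSpace ℂ (Fin n × Fin n) =>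
        entanglement (applyWithAncillas U (productVec γ.1 γ.2))) '' K := by
    ext e
    constructor
    · rintro ⟨r, s, α, β, hα, hβ, rfl⟩
      obtain ⟨α', hα', hαα⟩ := exists_square_coeffMatrix α
      obtain ⟨β', hβ', hββ⟩ := exists_square_coeffMatrix β
      refine ⟨(α', β'), hmem.2 ⟨hα'.trans hα, hβ'.trans hβ⟩, ?_⟩
      -- Only the ancilla of the second system can be replaced directly; the first is handled by
      -- exchanging the systems and exchanging back.
      rw [entanglement_congr_right U α β β' hββ, ← entanglement_swapSystems U α,
        entanglement_congr_right _ β' α α' hαα, entanglement_swapSystems]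
    · rintro ⟨γ, hγ, rfl⟩
      exact ⟨m, n, γ.1, γ.2, (hmem.1 hγ).1, (hmem.1 hγ).2, rfl⟩
  have hKne : K.Nonempty := by
    rw [himage] at hne
    exact Set.image_nonempty.1 hne
  have hcont : Continuous fun γ : EuclideanSpace ℂ (Fin m × Fin m) ×
      EuclideanSpace ℂ (Fin n × Fin n) => applyWithAncillas U (productVec γ.1 γ.2) := by
    refine continuous_pi fun p => ?_
    simp only [applyWithAncillas, productVec]
    fun_prop
  obtain ⟨γ, hγ, hmax⟩ := hKc.exists_isMaxOn hKne
    (continuousOn_entanglement.comp hcont.continuousOn fun γ hγ =>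
      sum_norm_sq_applyWithAncillas hU γ.1 γ.2 (hmem.1 hγ).1 (hmem.1 hγ).2)
  rw [himage]
  refine ⟨_, ⟨γ, hγ, rfl⟩, ?_⟩
  rintro _ ⟨δ, hδ, rfl⟩
  exact hmax hδ

/-! ### Real superpositions of basis vectors as inputs -/

section Superposition

/-- The vector `∑ i, c i |x i⟩`. -/
def superposition {ι V : Type*} [Fintype ι] [DecidableEq V] (c : ι → ℝ) (x : ι → V) : V → ℂ :=
  fun z => ∑ i, if x i = z then (c i : ℂ) else 0

theorem sum_star_superposition_mul {ι κ V : Type*} [Fintype ι] [Fintype κ] [Fintype V]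
    [DecidableEq V] (c : ι → ℝ) (x : ι → V) (d : κ → ℝ) (y : κ → V) :
    ∑ z, star (superposition c x z) * superposition d y z =
      ((∑ i, ∑ j, if x i = y j then c i * d j else 0 : ℝ) : ℂ) := by
  simp only [superposition, star_sum, Finset.sum_mul_sum]
  rw [Finset.sum_comm]
  push_cast
  refine Finset.sum_congr rfl fun i _ => ?_
  rw [Finset.sum_comm]
  refine Finset.sum_congr rfl fun j _ => ?_
  rw [Finset.sum_eq_single (x i) (fun z _ hz => by simp [Ne.symm hz]) (by simp)]
  by_cases h : x i = y j
  · simp [h]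
  · simp [h, Ne.symm h]

theorem norm_superposition {ι V : Type*} [Fintype ι] [Fintype V] [DecidableEq V]
    {c : ι → ℝ} {x : ι → V} (h : (∑ i, ∑ j, if x i = x j then c i * c j else 0) = 1) :
    ‖(WithLp.toLp 2 (superposition c x) : EuclideanSpace ℂ V)‖ = 1 := by
  have h1 := sum_star_superposition_mul c x c x
  rw [h] at h1
  have h2 : ‖(WithLp.toLp 2 (superposition c x) : EuclideanSpace ℂ V)‖ ^ 2 = 1 := by
    rw [EuclideanSpace.norm_sq_eq, ← Complex.ofReal_inj, ← h1]
    simp [Complex.conj_mul']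
  exact (pow_eq_one_iff_of_nonneg (norm_nonneg _) two_ne_zero).1 h2

/-- The entanglement of `∑ k, w k |F k⟩|g (τ k)⟩` with `g` injective. -/
theorem entanglement_superposition {κ ι V W : Type*} [Fintype κ] [Fintype ι] [DecidableEq ι]
    [Fintype V] [DecidableEq V] [Fintype W] [DecidableEq W] (w : κ → ℝ) (F : κ → V) (τ : κ → ι)
    (g : ι → W) (hg : Function.Injective g) (N : Matrix ι ι ℝ) (c : ι → ℝ)
    (hN : ∀ s t, (∑ k, ∑ k', if τ k = s ∧ τ k' = t ∧ F k = F k' then w k * w k' else 0) = N s t)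
    (hc : N.charpoly = ∏ t, (X - C (c t))) :
    entanglement (fun p : V × W => ∑ k, if F k = p.1 ∧ g (τ k) = p.2 then (w k : ℂ) else 0) =
      ∑ t, -(c t * Real.logb 2 (c t)) := by
  set a : ι → V → ℂ := fun t => superposition (fun k => if τ k = t then w k else 0) F with ha
  set b : ι → W → ℂ := fun t => superposition (fun _ : Unit => 1) (fun _ => g t) with hb
  have hψ : (fun p : V × W => ∑ k, if F k = p.1 ∧ g (τ k) = p.2 then (w k : ℂ) else 0) =
      fun p => ∑ t, a t p.1 * b t p.2 := by
    ext p
    simp only [ha, hb, superposition, Finset.univ_unique, Finset.sum_singleton, Finset.sum_mul]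
    rw [Finset.sum_comm]
    refine Finset.sum_congr rfl fun k _ => ?_
    rw [Finset.sum_eq_single (τ k) (fun t _ ht => by simp [Ne.symm ht]) (by simp)]
    by_cases h1 : F k = p.1 <;> by_cases h2 : g (τ k) = p.2 <;> simp [h1, h2]
  rw [hψ]
  refine entanglement_sum_eq a b (N.map Complex.ofRealHom) c (fun s t => ?_) (fun s t => ?_) ?_
  · have h := sum_star_superposition_mul (fun _ : Unit => 1) (fun _ => g t)
      (fun _ : Unit => 1) (fun _ => g s)
    simp only [hb, mul_comm (superposition _ _ _) (star _), h]
    simp only [Finset.univ_unique, Finset.sum_singleton, hg.eq_iff, eq_comm (a := t), mul_one]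
    split_ifs <;> simp
  · rw [map_apply, ← hN, ha, sum_star_superposition_mul, Complex.ofRealHom_eq_coe,
      Complex.ofReal_inj]
    refine Finset.sum_congr rfl fun k _ => Finset.sum_congr rfl fun k' _ => ?_
    by_cases h1 : τ k = s <;> by_cases h2 : τ k' = t <;> simp [h1, h2]
  · rw [charpoly_map, hc]
    simp [Polynomial.map_prod]

variable {a b : Type*} [Fintype a] [DecidableEq a] [Fintype b] [DecidableEq b]
  {U : Matrix (a × b) (a × b) ℂ} {π : Equiv.Perm (a × b)}

theorem applyWithAncillas_superposition {I J r s : Type*} [Fintype I] [Fintype J]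
    [DecidableEq r] [DecidableEq s] (hU : ∀ i j, U i j = if π j = i then 1 else 0)
    (c : I → ℝ) (x : I → a × r) (d : J → ℝ) (y : J → b × s) :
    applyWithAncillas U (productVec (WithLp.toLp 2 (superposition c x))
        (WithLp.toLp 2 (superposition d y))) =
      fun p => ∑ k : I × J, if ((π ((x k.1).1, (y k.2).1)).1, (x k.1).2) = p.1 ∧
        ((π ((x k.1).1, (y k.2).1)).2, (y k.2).2) = p.2 then ((c k.1 * d k.2 : ℝ) : ℂ) else 0 := by
  ext ⟨⟨i, p⟩, ⟨j, q⟩⟩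
  rw [applyWithAncillas_perm hU]
  simp only [productVec, superposition, Finset.sum_mul_sum, Fintype.sum_prod_type]
  refine Finset.sum_congr rfl fun k _ => Finset.sum_congr rfl fun l _ => ?_
  rw [ite_zero_mul_ite_zero, Complex.ofReal_mul]
  refine if_congr ?_ rfl rfl
  have h : π ((x k).1, (y l).1) = (i, j) ↔ ((x k).1, (y l).1) = π.symm (i, j) :=
    (Equiv.eq_symm_apply π).symm
  simp only [Prod.ext_iff] at h ⊢
  tauto

/-- The map `τ` names the B-side basis vector reached by each pair of input terms. Terms with the
same name are collected, and `N` is the Gram matrix of the resulting A-side vectors. -/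
theorem mem_outputEntanglements_of_superposition {I J ι : Type*} [Fintype I] [Fintype J]
    [Fintype ι] [DecidableEq ι] {r s : ℕ} (hU : ∀ i j, U i j = if π j = i then 1 else 0)
    (c : I → ℝ) (x : I → a × Fin r) (d : J → ℝ) (y : J → b × Fin s)
    (hc : (∑ i, ∑ i', if x i = x i' then c i * c i' else 0) = 1)
    (hd : (∑ j, ∑ j', if y j = y j' then d j * d j' else 0) = 1)
    (τ : I × J → ι) (g : ι → b × Fin s) (hg : Function.Injective g)
    (hτ : ∀ k : I × J, ((π ((x k.1).1, (y k.2).1)).2, (y k.2).2) = g (τ k))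
    (N : Matrix ι ι ℝ) (e : ι → ℝ)
    (hN : ∀ u v, (∑ k : I × J, ∑ k' : I × J, if τ k = u ∧ τ k' = v ∧
      ((π ((x k.1).1, (y k.2).1)).1, (x k.1).2) = ((π ((x k'.1).1, (y k'.2).1)).1, (x k'.1).2)
      then (c k.1 * d k.2) * (c k'.1 * d k'.2) else 0) = N u v)
    (he : N.charpoly = ∏ t, (X - C (e t))) :
    ∑ t, -(e t * Real.logb 2 (e t)) ∈ outputEntanglements U := by
  refine ⟨r, s, _, _, norm_superposition hc, norm_superposition hd, ?_⟩
  rw [applyWithAncillas_superposition hU]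
  simp only [hτ]
  exact (entanglement_superposition (fun k : I × J => c k.1 * d k.2)
    (fun k => ((π ((x k.1).1, (y k.2).1)).1, (x k.1).2)) τ g hg N e hN he).symm

end Superposition

/-! ### Spectra of block Gram matrices -/

section Charpoly

theorem charpoly_fin_three_of_block {p q r δ u v : ℝ} (h1 : u + v = q + r)
    (h2 : u * v = q * r - δ ^ 2) :
    (!![p, 0, 0; 0, q, δ; 0, δ, r] : Matrix (Fin 3) (Fin 3) ℝ).charpoly =
      ∏ t, (X - C ((![p, u, v] : Fin 3 → ℝ) t)) := by
  refine Polynomial.funext fun z => ?_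
  rw [eval_charpoly, det_fin_three]
  simp [Fin.prod_univ_three, eval_mul, Matrix.scalar_apply]
  linear_combination (z - p) * z * h1 - (z - p) * h2

theorem charpoly_fin_four_of_block {p p' q r δ u v : ℝ} (h1 : u + v = q + r)
    (h2 : u * v = q * r - δ ^ 2) :
    (!![p, 0, 0, 0; 0, p', 0, 0; 0, 0, q, δ; 0, 0, δ, r] : Matrix (Fin 4) (Fin 4) ℝ).charpoly =
      ∏ t, (X - C ((![p, p', u, v] : Fin 4 → ℝ) t)) := by
  refine Polynomial.funext fun z => ?_
  rw [eval_charpoly, det_succ_row_zero]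
  simp [Fin.sum_univ_four, Fin.prod_univ_four, eval_mul, Matrix.scalar_apply, det_fin_three,
    Fin.succAbove, Matrix.submatrix_apply]
  linear_combination (z - p) * (z - p') * z * h1 - (z - p) * (z - p') * h2

end Charpoly

/-! ### Numerical bounds on logarithms and entropies of explicit spectra -/

section Logarithms

theorem logb_two_three_lt : Real.logb 2 3 < 1.58511 := by
  -- 149/94 ≈ 1.58511 is a sharp upper approximation of log₂ 3. The stated error for log₂ 9 − 16/9
  -- requires log₂ 3 < 1.58514.
  have h : Real.logb 2 ((3 : ℝ) ^ 94) < Real.logb 2 ((2 : ℝ) ^ 149) :=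
    Real.logb_lt_logb (by norm_num) (by norm_num) (by norm_num)
  rw [Real.logb_pow, Real.logb_pow, Real.logb_self_eq_one one_lt_two] at h
  norm_num at h ⊢
  linarith

theorem lt_logb_two_three : 1.5848 < Real.logb 2 3 := by
  have h : Real.logb 2 ((2 : ℝ) ^ 84) < Real.logb 2 ((3 : ℝ) ^ 53) :=
    Real.logb_lt_logb (by norm_num) (by norm_num) (by norm_num)
  rw [Real.logb_pow, Real.logb_pow, Real.logb_self_eq_one one_lt_two] at h
  norm_num at h ⊢
  linarith

theorem logb_two_five_lt : Real.logb 2 5 < 12 / 5 := by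
  have h : Real.logb 2 ((5 : ℝ) ^ 5) < Real.logb 2 ((2 : ℝ) ^ 12) :=
    Real.logb_lt_logb (by norm_num) (by norm_num) (by norm_num)
  rw [Real.logb_pow, Real.logb_pow, Real.logb_self_eq_one one_lt_two] at h
  norm_num at h ⊢
  linarith

theorem logb_two_nine : Real.logb 2 9 = 2 * Real.logb 2 3 := by
  rw [show (9 : ℝ) = 3 ^ 2 by norm_num, Real.logb_pow]
  norm_num

theorem logb_two_four : Real.logb 2 4 = 2 := by
  rw [show (4 : ℝ) = 2 ^ 2 by norm_num, Real.logb_pow, Real.logb_self_eq_one one_lt_two]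
  norm_num

theorem mul_logb_div_nine {n : ℝ} (hn : n ≠ 0) :
    n / 9 * Real.logb 2 (n / 9) = n / 9 * (Real.logb 2 n - 2 * Real.logb 2 3) := by
  rw [Real.logb_div hn (by norm_num), logb_two_nine]

theorem entropy_four_four_one :
    ∑ t, -((![4 / 9, 4 / 9, 1 / 9] : Fin 3 → ℝ) t *
      Real.logb 2 ((![4 / 9, 4 / 9, 1 / 9] : Fin 3 → ℝ) t)) = Real.logb 2 9 - 16 / 9 := by
  simp only [Fin.sum_univ_three, cons_val_zero, cons_val_one, cons_val]
  rw [mul_logb_div_nine four_ne_zero, mul_logb_div_nine one_ne_zero, logb_two_nine, logb_two_four,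
    Real.logb_one]
  ring

theorem le_entropy_four_three_two :
    Real.logb 2 9 - 16 / 9 ≤ ∑ t, -((![4 / 9, 3 / 9, 2 / 9] : Fin 3 → ℝ) t *
      Real.logb 2 ((![4 / 9, 3 / 9, 2 / 9] : Fin 3 → ℝ) t)) := by
  simp only [Fin.sum_univ_three, cons_val_zero, cons_val_one, cons_val]
  rw [mul_logb_div_nine four_ne_zero, mul_logb_div_nine two_ne_zero,
    mul_logb_div_nine three_ne_zero, logb_two_nine, logb_two_four,
    Real.logb_self_eq_one one_lt_two]
  have := logb_two_three_lt
  norm_num at this ⊢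
  linarith

theorem le_entropy_four_two_three_zero :
    Real.logb 2 9 - 16 / 9 ≤ ∑ t, -((![4 / 9, 2 / 9, 3 / 9, 0] : Fin 4 → ℝ) t *
      Real.logb 2 ((![4 / 9, 2 / 9, 3 / 9, 0] : Fin 4 → ℝ) t)) := by
  simp only [Fin.sum_univ_four, cons_val_zero, cons_val_one, cons_val]
  rw [mul_logb_div_nine four_ne_zero, mul_logb_div_nine two_ne_zero,
    mul_logb_div_nine three_ne_zero, logb_two_nine, logb_two_four,
    Real.logb_self_eq_one one_lt_two]
  have := logb_two_three_lt
  norm_num at this ⊢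
  linarith

theorem le_entropy_four_two_two_one :
    Real.logb 2 9 - 16 / 9 ≤ ∑ t, -((![4 / 9, 2 / 9, 2 / 9, 1 / 9] : Fin 4 → ℝ) t *
      Real.logb 2 ((![4 / 9, 2 / 9, 2 / 9, 1 / 9] : Fin 4 → ℝ) t)) := by
  simp only [Fin.sum_univ_four, cons_val_zero, cons_val_one, cons_val]
  rw [mul_logb_div_nine four_ne_zero, mul_logb_div_nine two_ne_zero,
    mul_logb_div_nine one_ne_zero, logb_two_nine, logb_two_four, Real.logb_one,
    Real.logb_self_eq_one one_lt_two]
  linarith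

theorem le_entropy_five_two_two :
    Real.logb 2 9 - 16 / 9 ≤ ∑ t, -((![5 / 9, 2 / 9, 2 / 9] : Fin 3 → ℝ) t *
      Real.logb 2 ((![5 / 9, 2 / 9, 2 / 9] : Fin 3 → ℝ) t)) := by
  simp only [Fin.sum_univ_three, cons_val_zero, cons_val_one, cons_val]
  rw [mul_logb_div_nine (by norm_num : (5 : ℝ) ≠ 0), mul_logb_div_nine two_ne_zero, logb_two_nine,
    Real.logb_self_eq_one one_lt_two]
  have := logb_two_five_lt
  linarith

theorem le_entropy_three_three_three :
    Real.logb 2 9 - 16 / 9 ≤ ∑ t, -((![3 / 9, 3 / 9, 3 / 9] : Fin 3 → ℝ) t *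
      Real.logb 2 ((![3 / 9, 3 / 9, 3 / 9] : Fin 3 → ℝ) t)) := by
  simp only [Fin.sum_univ_three, cons_val_zero, cons_val_one, cons_val]
  rw [mul_logb_div_nine three_ne_zero, logb_two_nine]
  have := logb_two_three_lt
  norm_num at this ⊢
  linarith

end Logarithms

/-! ### Lower bound when neither output is locally determined -/

section Uncontrolled

variable {a b : Type*} [Fintype a] [DecidableEq a] [Fintype b] [DecidableEq b]
  {U : Matrix (a × b) (a × b) ℂ} {π : Equiv.Perm (a × b)}

theorem sum_pair_eq_one {V : Type*} [DecidableEq V] (z z' : V) {u v : ℝ} (h : u * u + v * v = 1) :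
    (∑ i : Fin 2, ∑ i' : Fin 2,
      if (![(z, 0), (z', 1)] : Fin 2 → V × Fin 2) i = (![(z, 0), (z', 1)] : Fin 2 → V × Fin 2) i'
      then (![u, v] : Fin 2 → ℝ) i * (![u, v] : Fin 2 → ℝ) i' else 0) = 1 := by
  simpa [Fin.sum_univ_two] using h

/-- If neither output of the permutation `π` is a function of one of the inputs alone, in the sense
of `hf` and `hg`, then the lower bound holds. -/
theorem exists_le_outputEntanglements_of_ne (hU : ∀ i j, U i j = if π j = i then 1 else 0)
    {k k' : a} {l l' : b} (hf : (π (k, l)).1 ≠ (π (k, l')).1)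
    (hg : (π (k, l)).2 ≠ (π (k', l)).2) :
    ∃ e ∈ outputEntanglements U, Real.logb 2 9 - 16 / 9 ≤ e := by
  -- Both inputs carry squared weights 2/3, 1/3, so the four output terms have squared weights 4/9,
  -- 2/9, 2/9, 1/9. The hypotheses `hf`, `hg` and the ancilla labels isolate the term 4/9 in the
  -- Gram matrix.
  obtain ⟨u, v, huu, hvv⟩ : ∃ u v : ℝ, u * u = 2 / 3 ∧ v * v = 1 / 3 :=
    ⟨√(2 / 3), √(1 / 3), Real.mul_self_sqrt (by norm_num), Real.mul_self_sqrt (by norm_num)⟩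
  have huv : u * u + v * v = 1 := by rw [huu, hvv]; norm_num
  have h44 : u * u * (u * u) = 4 / 9 := by rw [huu]; norm_num
  have h42 : u * v * (u * v) = 2 / 9 := by rw [mul_mul_mul_comm, huu, hvv]; norm_num
  have h24 : v * u * (v * u) = 2 / 9 := by rw [mul_mul_mul_comm, huu, hvv]; norm_num
  have h22 : v * v * (v * v) = 1 / 9 := by rw [hvv]; norm_num
  by_cases h2 : (π (k, l')).2 = (π (k', l')).2
  -- The terms from (k, l') and (k', l') share a B-vector, giving squared norm 3/9. The only
  -- possible overlap `ε` is between this A-vector and that of (k', l). If nonzero, ε² = 2/81 and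
  -- the block has eigenvalues 4/9, 1/9.
  · have key : ∀ (ε p q : ℝ), p + q = 3 / 9 + 2 / 9 → p * q = 3 / 9 * (2 / 9) - ε ^ 2 →
        ((if (π (k', l)).1 = (π (k', l')).1 then v * u * (v * v) else 0) = ε) →
        ∑ t, -((![4 / 9, p, q] : Fin 3 → ℝ) t * Real.logb 2 ((![4 / 9, p, q] : Fin 3 → ℝ) t)) ∈
          outputEntanglements U := by
      intro ε p q h3 h4 hε
      have hε' : (if (π (k', l')).1 = (π (k', l)).1 then v * v * (v * u) else 0) = ε := by
        rw [← hε, mul_comm (v * v), eq_comm]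
        simp only [eq_comm]
      refine mem_outputEntanglements_of_superposition (ι := Fin 3) (r := 2) (s := 2) hU
        ![u, v] ![(k, 0), (k', 1)] ![u, v] ![(l, 0), (l', 1)]
        (sum_pair_eq_one _ _ huv) (sum_pair_eq_one _ _ huv)
        (fun m => (![![0, 1], ![2, 1]] : Fin 2 → Fin 2 → Fin 3) m.1 m.2)
        ![((π (k, l)).2, 0), ((π (k, l')).2, 1), ((π (k', l)).2, 0)] ?_ ?_
        !![4 / 9, 0, 0; 0, 3 / 9, ε; 0, ε, 2 / 9] ![4 / 9, p, q] ?_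
        (charpoly_fin_three_of_block h3 h4)
      · intro s t
        fin_cases s <;> fin_cases t <;> simp [hg, Ne.symm hg]
      · rintro ⟨m, n⟩
        fin_cases m <;> fin_cases n <;> simp [h2]
      · intro s t
        fin_cases s <;> fin_cases t <;>
          simp [Fintype.sum_prod_type, Fin.sum_univ_two, h44, h42, h24, h22, hf, Ne.symm hf, hε, hε']
        norm_num
    by_cases h3 : (π (k', l)).1 = (π (k', l')).1
    · exact ⟨_, key (v * u * (v * v)) (4 / 9) (1 / 9) (by norm_num)
        (by linear_combination (v * v * u * u) * h22 + 1 / 9 * h24) (if_pos h3),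
        entropy_four_four_one.ge⟩
    · exact ⟨_, key 0 (3 / 9) (2 / 9) (by norm_num) (by norm_num) (if_neg h3),
        le_entropy_four_three_two⟩
  -- Now all four B-vectors differ. When ε² = 2/81 the last block is singular, with eigenvalues 3/9
  -- and 0.
  · have key : ∀ (ε p q : ℝ), p + q = 2 / 9 + 1 / 9 → p * q = 2 / 9 * (1 / 9) - ε ^ 2 →
        ((if (π (k', l)).1 = (π (k', l')).1 then v * u * (v * v) else 0) = ε) →
        ∑ t, -((![4 / 9, 2 / 9, p, q] : Fin 4 → ℝ) t *
          Real.logb 2 ((![4 / 9, 2 / 9, p, q] : Fin 4 → ℝ) t)) ∈ outputEntanglements U := by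
      intro ε p q h3 h4 hε
      have hε' : (if (π (k', l')).1 = (π (k', l)).1 then v * v * (v * u) else 0) = ε := by
        rw [← hε, mul_comm (v * v), eq_comm]
        simp only [eq_comm]
      refine mem_outputEntanglements_of_superposition (ι := Fin 4) (r := 2) (s := 2) hU
        ![u, v] ![(k, 0), (k', 1)] ![u, v] ![(l, 0), (l', 1)]
        (sum_pair_eq_one _ _ huv) (sum_pair_eq_one _ _ huv)
        (fun m => (![![0, 1], ![2, 3]] : Fin 2 → Fin 2 → Fin 4) m.1 m.2)
        ![((π (k, l)).2, 0), ((π (k, l')).2, 1), ((π (k', l)).2, 0), ((π (k', l')).2, 1)] ?_ ?_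
        !![4 / 9, 0, 0, 0; 0, 2 / 9, 0, 0; 0, 0, 2 / 9, ε; 0, 0, ε, 1 / 9] ![4 / 9, 2 / 9, p, q] ?_
        (charpoly_fin_four_of_block h3 h4)
      · intro s t
        fin_cases s <;> fin_cases t <;> simp [hg, Ne.symm hg, h2, Ne.symm h2]
      · rintro ⟨m, n⟩
        fin_cases m <;> fin_cases n <;> simp
      · intro s t
        fin_cases s <;> fin_cases t <;>
          simp [Fintype.sum_prod_type, Fin.sum_univ_two, h44, h42, h24, h22, hf, Ne.symm hf, hε, hε']
    by_cases h3 : (π (k', l)).1 = (π (k', l')).1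
    · exact ⟨_, key (v * u * (v * v)) (3 / 9) 0 (by norm_num)
        (by linear_combination (v * v * u * u) * h22 + 1 / 9 * h24) (if_pos h3),
        le_entropy_four_two_three_zero⟩
    · exact ⟨_, key 0 (2 / 9) (1 / 9) (by norm_num) (by norm_num) (if_neg h3),
        le_entropy_four_two_two_one⟩

end Uncontrolled

/-! ### Lower bound for controlled permutations -/

section Controlled

variable {a b : Type*} [Fintype a] [DecidableEq a] [Fintype b] [DecidableEq b]
  {U : Matrix (a × b) (a × b) ℂ} {π : Equiv.Perm (a × b)} {Q : b → Equiv.Perm a}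
  {w : Equiv.Perm b}

/-- Applying functionals dual to the independent `B m` to U = ∑ P(Q l) ⊗ |w l⟩⟨l| puts every `A m`
in the span of the permutation matrices of the `Q l`, and the `A m` are independent. -/
theorem three_le_card_of_hasSchmidtRank (hU : ∀ i j, U i j = if π j = i then 1 else 0)
    (hπ : ∀ k l, π (k, l) = (Q l k, w l)) {n : ℕ} (hr : HasSchmidtRank U n) :
    n ≤ (Finset.univ.image Q).card := by
  classical
  obtain ⟨A, B, hA, hB, hAB⟩ := hr
  obtain ⟨T, hT⟩ := (Finsupp.linearCombination ℂ B).exists_leftInverse_of_injective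
    (LinearMap.ker_eq_bot.2 hB)
  have hTB : ∀ m, T (B m) = Finsupp.single m 1 := fun m => by
    have := LinearMap.congr_fun hT (Finsupp.single m 1)
    simpa using this
  set pm : Equiv.Perm a → Matrix a a ℂ := fun q => Matrix.of fun i k => if q k = i then 1 else 0
    with hpm
  have hmem : ∀ m, A m = ∑ l, T (Matrix.single (w l) l 1) m • pm (Q l) := by
    intro m
    ext i k
    have h1 : (∑ m, A m i k • B m) = ∑ l, (pm (Q l) i k) • Matrix.single (w l) l (1 : ℂ) := by
      ext j l
      have h2 : U (i, j) (k, l) = (∑ m, A m i k • B m) j l := by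
        simp [hAB, Matrix.sum_apply]
      rw [← h2, hU, hπ, Matrix.sum_apply]
      rw [Finset.sum_eq_single l (fun l' _ hl => by simp [Matrix.single, hl]) (by simp)]
      by_cases h3 : Q l k = i <;> by_cases h4 : w l = j <;> simp [hpm, Matrix.single, h3, h4]
    have h2 := congrArg (fun z => T z m) h1
    simp only [map_sum, map_smul, hTB, Finsupp.coe_finsetSum, Finset.sum_apply, Finsupp.smul_apply,
      Finsupp.single_apply] at h2
    simp only [smul_eq_mul, mul_ite, mul_one, mul_zero, Finset.sum_ite_eq', Finset.mem_univ,
      if_true] at h2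
    rw [h2, Matrix.sum_apply]
    simp [mul_comm]
  have hle : Submodule.span ℂ (Set.range A) ≤
      Submodule.span ℂ (((Finset.univ.image Q).image pm : Finset (Matrix a a ℂ)) :
        Set (Matrix a a ℂ)) := by
    rw [Submodule.span_le]
    rintro _ ⟨m, rfl⟩
    rw [SetLike.mem_coe, hmem m]
    refine Submodule.sum_mem _ fun l _ => Submodule.smul_mem _ _ (Submodule.subset_span ?_)
    simp
  have h3 := Submodule.finrank_mono hle
  rw [finrank_span_eq_card hA, Fintype.card_fin] at h3
  exact h3.trans ((finrank_span_finset_le_card _).trans Finset.card_image_le)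

/-- With β uniform over three control values, distinct `w (l n)` give orthonormal B-vectors, so the
Gram matrix is one third of the overlaps of the three images of α. This is the source of the factor
3 in `hN`. -/
theorem mem_outputEntanglements_of_controlled {I : Type*} [Fintype I] {r : ℕ}
    (hU : ∀ i j, U i j = if π j = i then 1 else 0) (hπ : ∀ k l, π (k, l) = (Q l k, w l))
    (l : Fin 3 → b) (hl : Function.Injective l) (c : I → ℝ) (x : I → a × Fin r)
    (hc : (∑ i, ∑ i', if x i = x i' then c i * c i' else 0) = 1)
    (N : Matrix (Fin 3) (Fin 3) ℝ) (e : Fin 3 → ℝ)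
    (hN : ∀ s t, (∑ i, ∑ i', if Q (l s) (x i).1 = Q (l t) (x i').1 ∧ (x i).2 = (x i').2
      then c i * c i' else 0) = 3 * N s t)
    (he : N.charpoly = ∏ t, (X - C (e t))) :
    ∑ t, -(e t * Real.logb 2 (e t)) ∈ outputEntanglements U := by
  obtain ⟨d, hd⟩ : ∃ d : ℝ, d * d = 1 / 3 := ⟨√(1 / 3), Real.mul_self_sqrt (by norm_num)⟩
  refine mem_outputEntanglements_of_superposition (s := 1) hU c x (fun _ : Fin 3 => d)
    (fun n => (l n, 0)) hc ?_ (fun k => k.2) (fun n => (w (l n), 0)) (fun m n h => ?_)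
    (fun k => by simp [hπ]) N e (fun s t => ?_) he
  · simp [Prod.ext_iff, hl.eq_iff, hd]
  · simpa [hl.eq_iff] using h
  · have h1 : ∀ i i' : I, (∑ n : Fin 3, ∑ n' : Fin 3, if n = s ∧ n' = t ∧
        (Q (l n) (x i).1, (x i).2) = (Q (l n') (x i').1, (x i').2)
        then c i * d * (c i' * d) else 0) = 1 / 3 *
          (if Q (l s) (x i).1 = Q (l t) (x i').1 ∧ (x i).2 = (x i').2 then c i * c i' else 0) := by
      intro i i'
      rw [Finset.sum_eq_single s (fun n _ hn => by simp [hn]) (by simp),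
        Finset.sum_eq_single t (fun n _ hn => by simp [hn]) (by simp), ← hd]
      simp only [true_and, Prod.mk.injEq]
      split_ifs <;> ring
    simp only [Fintype.sum_prod_type, hπ]
    have h2 := hN s t
    calc _ = ∑ i : I, ∑ i' : I, ∑ n : Fin 3, ∑ n' : Fin 3, (if n = s ∧ n' = t ∧
        (Q (l n) (x i).1, (x i).2) = (Q (l n') (x i').1, (x i').2)
        then c i * d * (c i' * d) else 0) :=
          Finset.sum_congr rfl fun i _ => Finset.sum_comm
      _ = N s t := by
        simp only [h1, ← Finset.mul_sum, h2]
        ring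

/-- Conjugation by diag(ε, 1, 1) makes all off-diagonal entries εδ, leaving a scalar plus εδ times
the all-ones matrix. -/
theorem charpoly_fin_three_of_sign {p δ ε : ℝ} (hε : ε * ε = 1) :
    (!![p, δ, δ; δ, p, ε * δ; δ, ε * δ, p] : Matrix (Fin 3) (Fin 3) ℝ).charpoly =
      ∏ t, (X - C ((![p - ε * δ, p - ε * δ, p + 2 * ε * δ] : Fin 3 → ℝ) t)) := by
  refine Polynomial.funext fun z => ?_
  rw [eval_charpoly, det_fin_three]
  simp [Fin.prod_univ_three, eval_mul, Matrix.scalar_apply]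
  linear_combination (2 * δ ^ 2 * (z - p) + 2 * ε * δ ^ 3) * hε

/-- Relative to `Q l₁`, the other two permutations become `R` and `S` with disjoint supports. An α
with half its weight on each support, and alternating signs, can be tuned so that α, Rα, Sα have
overlaps 1/3, 1/3, −1/3. The Gram spectrum is then (4/9, 4/9, 1/9). -/
theorem exists_le_outputEntanglements_of_disjoint
    (hU : ∀ i j, U i j = if π j = i then 1 else 0) (hπ : ∀ k l, π (k, l) = (Q l k, w l))
    {l₁ l₂ l₃ : b} (h12 : Q l₁ ≠ Q l₂) (h13 : Q l₁ ≠ Q l₃) (h23 : Q l₂ ≠ Q l₃)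
    (hdisj : ∀ k, Q l₁ k = Q l₂ k ∨ Q l₁ k = Q l₃ k) :
    ∃ e ∈ outputEntanglements U, Real.logb 2 9 - 16 / 9 ≤ e := by
  set R : Equiv.Perm a := (Q l₁)⁻¹ * Q l₂
  set S : Equiv.Perm a := (Q l₁)⁻¹ * Q l₃
  have hR : ∀ x, Q l₂ x = Q l₁ (R x) := fun x => by simp [R]
  have hS : ∀ x, Q l₃ x = Q l₁ (S x) := fun x => by simp [S]
  have hRS : ∀ x, R x ≠ x → S x = x := fun x hx => by
    rcases hdisj x with h | h
    · exact absurd ((Q l₁).injective (by rw [← hR, h])) hx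
    · exact (Q l₁).injective (by rw [← hS, h])
  have hSR : ∀ x, S x ≠ x → R x = x := fun x hx => by
    by_contra h
    exact hx (hRS x h)
  obtain ⟨k, hk⟩ : ∃ k, R k ≠ k := by
    by_contra! h
    exact h12 (Equiv.ext fun x => by rw [hR, h])
  obtain ⟨k', hk'⟩ : ∃ k, S k ≠ k := by
    by_contra! h
    exact h13 (Equiv.ext fun x => by rw [hS, h])
  have hk2 : R (R k) ≠ R k := fun h => hk (R.injective h)
  have hk3 : R (R (R k)) ≠ R (R k) := fun h => hk2 (R.injective h)
  have hk2' : S (S k') ≠ S k' := fun h => hk' (S.injective h)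
  have hk3' : S (S (S k')) ≠ S (S k') := fun h => hk2' (S.injective h)
  have hne : ∀ {x y}, R x ≠ x → S y ≠ y → x ≠ y := fun hx hy h => hy (h ▸ hRS _ hx)
  have hpq : ∀ ε : ℝ, 0 ≤ ε → ε ≤ 1 / 4 → ∃ p q : ℝ, p * p + q * q = 1 / 2 ∧ p * q = ε := by
    intro ε h0 h1
    -- Solve (p + q)² = 1/2 + 2ε and (p − q)² = 1/2 − 2ε.
    have hs := Real.mul_self_sqrt (show (0 : ℝ) ≤ 1 / 2 + 2 * ε by linarith)
    have ht := Real.mul_self_sqrt (show (0 : ℝ) ≤ 1 / 2 - 2 * ε by linarith)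
    refine ⟨(√(1 / 2 + 2 * ε) + √(1 / 2 - 2 * ε)) / 2, (√(1 / 2 + 2 * ε) - √(1 / 2 - 2 * ε)) / 2,
      ?_, ?_⟩
    · linear_combination (hs + ht) / 2
    · linear_combination (hs - ht) / 4
  -- `P` will say that the point lies on a 2-cycle, in which case the product pq enters the overlap
  -- twice.
  have hpq' : ∀ (P : Prop) [Decidable P], ∃ p q : ℝ, p * p + q * q = 1 / 2 ∧
      p * q + (if P then p * q else 0) = 1 / 6 := by
    intro P _
    by_cases hP : P
    · obtain ⟨p, q, h1, h2⟩ := hpq (1 / 12) (by norm_num) (by norm_num)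
      exact ⟨p, q, h1, by rw [if_pos hP, h2]; norm_num⟩
    · obtain ⟨p, q, h1, h2⟩ := hpq (1 / 6) (by norm_num) (by norm_num)
      exact ⟨p, q, h1, by rw [if_neg hP, h2]; norm_num⟩
  obtain ⟨p, q, hpq1, hpq2⟩ := hpq' (R (R k) = k)
  obtain ⟨p', q', hpq1', hpq2'⟩ := hpq' (S (S k') = k')
  have n1 := hne hk hk'
  have n2 := hne hk hk2'
  have n3 := hne hk hk3'
  have n4 := hne hk2 hk'
  have n5 := hne hk2 hk2'
  have n6 := hne hk2 hk3'
  have n7 := hne hk3 hk'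
  have n8 := hne hk3 hk2'
  have n9 := hne hk3 hk3'
  have hl : Function.Injective ![l₁, l₂, l₃] := by
    have e12 : l₁ ≠ l₂ := fun h => h12 (by rw [h])
    have e13 : l₁ ≠ l₃ := fun h => h13 (by rw [h])
    have e23 : l₂ ≠ l₃ := fun h => h23 (by rw [h])
    intro s t
    fin_cases s <;> fin_cases t <;> simp [e12, e13, e23, e12.symm, e13.symm, e23.symm]
  -- `R` fixes the half of α on the support of `S`, so ⟨α, Rα⟩ = 1/2 − 1/6 = 1/3, and likewise for
  -- `S`. In ⟨Rα, Sα⟩ each half contributes −1/6.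
  have mem := mem_outputEntanglements_of_controlled (r := 1) hU hπ ![l₁, l₂, l₃] hl
    ![p, -q, p', -q'] ![(k, 0), (R k, 0), (k', 0), (S k', 0)] ?_
    !![3 / 9, 1 / 9, 1 / 9; 1 / 9, 3 / 9, -1 * (1 / 9); 1 / 9, -1 * (1 / 9), 3 / 9] _ ?_
    (charpoly_fin_three_of_sign (by norm_num))
  · refine ⟨_, mem, ?_⟩
    have h := entropy_four_four_one.ge
    norm_num at h ⊢
    exact h
  · simp [Fin.sum_univ_four, hk, hk', hk.symm, hk'.symm, n1, n2, n4, n5, n1.symm, n2.symm,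
      n4.symm, n5.symm]
    linarith
  · intro s t
    fin_cases s <;> fin_cases t <;>
      simp [Fin.sum_univ_four, hR, hS, hk, hk', hk.symm, hk'.symm, hk2.symm, hk2'.symm,
        n1, n2, n3, n4, n5, n6, n7, n8, n9, n1.symm, n2.symm, n3.symm, n4.symm, n5.symm, n6.symm,
        n7.symm, n8.symm, n9.symm, hRS _ hk, hRS _ hk2, hSR _ hk', hSR _ hk2',
        eq_comm (a := k) (b := R (R k)), eq_comm (a := k') (b := S (S k'))]
    all_goals split_ifs at hpq2 hpq2' ⊢ <;> linarith

/-- Either one of the three permutations agrees everywhere with at least one of the other two (the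
disjoint case), or each has a point where it differs from both others. In the latter situation, a
point with three distinct images gives entropy log₂ 3; failing that, exactly one pair agrees at each
of the three points. -/
theorem exists_le_outputEntanglements_of_controlled
    (hU : ∀ i j, U i j = if π j = i then 1 else 0) (hπ : ∀ k l, π (k, l) = (Q l k, w l))
    (hr : HasSchmidtRank U 3) :
    ∃ e ∈ outputEntanglements U, Real.logb 2 9 - 16 / 9 ≤ e := by
  obtain ⟨_, h1, _, h2, _, h3, h12, h13, h23⟩ :=
    Finset.two_lt_card.1 (three_le_card_of_hasSchmidtRank hU hπ hr)
  obtain ⟨l₁, -, rfl⟩ := Finset.mem_image.1 h1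
  obtain ⟨l₂, -, rfl⟩ := Finset.mem_image.1 h2
  obtain ⟨l₃, -, rfl⟩ := Finset.mem_image.1 h3
  by_cases d1 : ∀ k, Q l₁ k = Q l₂ k ∨ Q l₁ k = Q l₃ k
  · exact exists_le_outputEntanglements_of_disjoint hU hπ h12 h13 h23 d1
  by_cases d2 : ∀ k, Q l₂ k = Q l₁ k ∨ Q l₂ k = Q l₃ k
  · exact exists_le_outputEntanglements_of_disjoint hU hπ h12.symm h23 h13 d2
  by_cases d3 : ∀ k, Q l₃ k = Q l₁ k ∨ Q l₃ k = Q l₂ k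
  · exact exists_le_outputEntanglements_of_disjoint hU hπ h13.symm h23.symm h12 d3
  push Not at d1 d2 d3
  obtain ⟨k₁, a1, b1⟩ := d1
  obtain ⟨k₂, a2, b2⟩ := d2
  obtain ⟨k₃, a3, b3⟩ := d3
  have hl : Function.Injective ![l₁, l₂, l₃] := by
    have e12 : l₁ ≠ l₂ := fun h => h12 (by rw [h])
    have e13 : l₁ ≠ l₃ := fun h => h13 (by rw [h])
    have e23 : l₂ ≠ l₃ := fun h => h23 (by rw [h])
    intro s t
    fin_cases s <;> fin_cases t <;> simp [e12, e13, e23, e12.symm, e13.symm, e23.symm]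
  have hdist : ∀ k, Q l₁ k ≠ Q l₂ k → Q l₁ k ≠ Q l₃ k → Q l₂ k ≠ Q l₃ k →
      ∃ e ∈ outputEntanglements U, Real.logb 2 9 - 16 / 9 ≤ e := by
    intro k e12 e13 e23
    refine ⟨_, mem_outputEntanglements_of_controlled (I := Unit) (r := 1) hU hπ ![l₁, l₂, l₃] hl
      (fun _ => 1) (fun _ => (k, 0)) (by simp)
      !![3 / 9, 0, 0; 0, 3 / 9, 0; 0, 0, 3 / 9] ![3 / 9, 3 / 9, 3 / 9] ?_
      (charpoly_fin_three_of_block (by norm_num) (by norm_num)), le_entropy_three_three_three⟩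
    intro s t
    fin_cases s <;> fin_cases t <;>
      simp [e12, e13, e23, e12.symm, e13.symm, e23.symm] <;> norm_num
  by_cases c1 : Q l₂ k₁ = Q l₃ k₁
  swap
  · exact hdist k₁ a1 b1 c1
  by_cases c2 : Q l₁ k₂ = Q l₃ k₂
  swap
  · exact hdist k₂ a2.symm c2 b2
  by_cases c3 : Q l₁ k₃ = Q l₂ k₃
  swap
  · exact hdist k₃ c3 a3.symm b3.symm
  obtain ⟨d, hd⟩ : ∃ d : ℝ, d * d = 1 / 3 := ⟨√(1 / 3), Real.mul_self_sqrt (by norm_num)⟩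
  -- The orthogonal ancilla labels prevent interference between the three points. Each pair of
  -- permutations agrees at exactly one of them, so every overlap is 1/3 and the spectrum is (2/9,
  -- 2/9, 5/9).
  have mem := mem_outputEntanglements_of_controlled (I := Fin 3) (r := 3) hU hπ ![l₁, l₂, l₃] hl
    (fun _ => d) ![(k₁, 0), (k₂, 1), (k₃, 2)] ?_
    !![3 / 9, 1 / 9, 1 / 9; 1 / 9, 3 / 9, 1 * (1 / 9); 1 / 9, 1 * (1 / 9), 3 / 9] _ ?_
    (charpoly_fin_three_of_sign (by norm_num))
  · refine ⟨_, mem, ?_⟩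
    have h := le_entropy_five_two_two
    simp [Fin.sum_univ_three] at h ⊢
    norm_num at h ⊢
    linarith
  · simp [Fin.sum_univ_three, hd]
    norm_num
  · intro s t
    fin_cases s <;> fin_cases t <;>
      simp [Fin.sum_univ_three, hd, c1, c2, c3, b1, b2, b3, b1.symm, b2.symm, b3.symm]
    all_goals norm_num

end Controlled

/-! ### Case distinction for the lower bound -/

section LowerBound

variable {a b : Type*} [Fintype a] [DecidableEq a] [Fintype b] [DecidableEq b]
  {U : Matrix (a × b) (a × b) ℂ} {π : Equiv.Perm (a × b)}

omit [DecidableEq a] [DecidableEq b] in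
/-- If the second output of `π` depends on the second input only, then `π` is a permutation of the
first system controlled by the second one, followed by a permutation of the second system. -/
theorem exists_controlled_of_snd_eq [Nonempty a] (h : ∀ k k' l, (π (k, l)).2 = (π (k', l)).2) :
    ∃ (Q : b → Equiv.Perm a) (w : Equiv.Perm b), ∀ k l, π (k, l) = (Q l k, w l) := by
  obtain ⟨k₀⟩ := ‹Nonempty a›
  have hinj : ∀ l, Function.Injective fun k => (π (k, l)).1 := fun l k k' hk => by
    have : π (k, l) = π (k', l) := Prod.ext hk (h k k' l)
    exact (Prod.mk.inj (π.injective this)).1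
  have hsurj : Function.Surjective fun l => (π (k₀, l)).2 := fun j => by
    refine ⟨(π.symm (k₀, j)).2, ?_⟩
    simp only
    rw [h k₀ (π.symm (k₀, j)).1, Prod.mk.eta, Equiv.apply_symm_apply]
  exact ⟨fun l => Equiv.ofBijective _ (Finite.injective_iff_bijective.1 (hinj l)),
    Equiv.ofBijective _ (Finite.surjective_iff_bijective.1 hsurj),
    fun k l => Prod.ext rfl (h k k₀ l)⟩

theorem exists_le_outputEntanglements [Nonempty a] [Nonempty b]
    (hU : ∀ i j, U i j = if π j = i then 1 else 0) (hr : HasSchmidtRank U 3) :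
    ∃ e ∈ outputEntanglements U, Real.logb 2 9 - 16 / 9 ≤ e := by
  by_cases h2 : ∀ k k' l, (π (k, l)).2 = (π (k', l)).2
  · obtain ⟨Q, w, hπ⟩ := exists_controlled_of_snd_eq h2
    exact exists_le_outputEntanglements_of_controlled hU hπ hr
  by_cases h1 : ∀ l l' k, (π (k, l)).1 = (π (k, l')).1
  · set σ : Equiv.Perm (b × a) := (Equiv.prodComm b a).trans (π.trans (Equiv.prodComm a b))
    have hσ : ∀ i j, swapSystems U i j = if σ j = i then 1 else 0 := fun i j => by
      rw [swapSystems, submatrix_apply, hU]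
      exact if_congr (by simp [σ, Prod.ext_iff, and_comm]) rfl rfl
    obtain ⟨Q, w, hπ⟩ := exists_controlled_of_snd_eq (π := σ) fun l l' k => h1 l l' k
    rw [← outputEntanglements_swapSystems]
    exact exists_le_outputEntanglements_of_controlled hσ hπ hr.swapSystems
  push Not at h1 h2
  obtain ⟨l₁, l₂, k, hf⟩ := h1
  obtain ⟨k₁, k₂, l, hg⟩ := h2
  -- The two failures of dependence are moved to a common base point (k, l): a nonconstant function
  -- takes a value different from the one at any given point.
  obtain ⟨l', hl⟩ : ∃ l', (π (k, l)).1 ≠ (π (k, l')).1 := by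
    by_contra! h
    exact hf ((h l₁).symm.trans (h l₂))
  obtain ⟨k', hk⟩ : ∃ k', (π (k, l)).2 ≠ (π (k', l)).2 := by
    by_contra! h
    exact hg ((h k₁).symm.trans (h k₂))
  exact exists_le_outputEntanglements_of_ne hU hl hk

end LowerBound

end EntPower

/-! ### Assembly of the bounds -/

theorem proposition1 :
    (∀ (dA dB : ℕ) (U : Matrix (Fin dA × Fin dB) (Fin dA × Fin dB) ℂ),
      EntPower.IsPermutationUnitary U → EntPower.HasSchmidtRank U 3 →
        -- the maximum defining the entangling power is attained, and it obeys both bounds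
        IsGreatest (EntPower.outputEntanglements U) (EntPower.entanglingPower U) ∧
        Real.logb 2 9 - 16 / 9 ≤ EntPower.entanglingPower U ∧
        EntPower.entanglingPower U ≤ Real.logb 2 3) ∧
    -- the numerical values of the bounds, correct to three decimals
    |Real.logb 2 9 - 16 / 9 - 1.392| < 0.0005 ∧ |Real.logb 2 3 - 1.585| < 0.0005 := by
  refine ⟨fun dA dB U hperm hr => ?_, ?_, ?_⟩
  · obtain ⟨π, hU⟩ := hperm.exists_perm
    -- Positivity of the dimensions follows from the Schmidt rank: over an empty index type every
    -- matrix is zero, contradicting linear independence.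
    obtain ⟨hA, hB⟩ : Nonempty (Fin dA) ∧ Nonempty (Fin dB) := by
      obtain ⟨A, B, hA, hB, -⟩ := hr
      refine ⟨?_, ?_⟩
      · by_contra h
        rw [not_nonempty_iff] at h
        exact hA.ne_zero 0 (Subsingleton.elim _ _)
      · by_contra h
        rw [not_nonempty_iff] at h
        exact hB.ne_zero 0 (Subsingleton.elim _ _)
    obtain ⟨e₀, he₀, hle⟩ := EntPower.exists_le_outputEntanglements hU hr
    obtain ⟨e, he⟩ := EntPower.exists_isGreatest_outputEntanglements hU ⟨e₀, he₀⟩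
    have heq : EntPower.entanglingPower U = e := he.csSup_eq
    rw [heq]
    refine ⟨he, hle.trans (he.2 he₀), ?_⟩
    exact_mod_cast EntPower.le_logb_of_mem_outputEntanglements three_pos hU hr he.1
  · have h1 := EntPower.lt_logb_two_three
    have h2 := EntPower.logb_two_three_lt
    rw [EntPower.logb_two_nine, abs_lt]
    norm_num at h1 h2 ⊢
    constructor <;> linarith
  · have h1 := EntPower.lt_logb_two_three
    have h2 := EntPower.logb_two_three_lt
    rw [abs_lt]
    norm_num at h1 h2 ⊢
    constructor <;> linarith
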